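/- Let $X_1, X_2, \ldots$ be integrable mean-zero real random variables on a probability space $(\Omega,\mathcal A,\mathbb P)$, and suppose that the sequence is associated: for every finite subsequence $(X_{k_1},\ldots,X_{k_p})$ and all coordinatewise non-decreasing Borel functions $h,g:\mathbb R^p\to\mathbb R$, one has $\operatorname{Cov}\big(h(X_{k_1},\ldots,X_{k_p}),g(X_{k_1},\ldots,X_{k_p})\big)\ge 0$ whenever this covariance exists. Put $S_n = X_1+\cdots+X_n$ and, when the variance is finite, $s_n=\sqrt{\operatorname{Var}(S_n)}$. Write $\rightsquigarrow$ for weak convergence. (1) Suppose that the sequence is (strictly) stationary, that $\mathbb E X_1^2<\infty$, and that $$\sigma^2=\operatorname{Var}(X_1)+2\sum_{j\ge 2}\operatorname{Cov}(X_1,X_j)<\infty .$$ Then $S_n/\sqrt n \rightsquigarrow \mathcal N(0,\sigma^2)$ as $n\to\infty$, where $\mathcal N(0,\sigma^2)$ is the centred normal law with variance $\sigma^2$ (the Dirac mass at $0$ if $\sigma=0$). (2) Without stationarity, suppose that there are integer sequences $\ell(n)\ge 1$, $m(n)\ge 0$, $r(n)$ and a real $\delta>0$ such that the following conditions hold as $n\to\infty$.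 (L) $n=m(n)\ell(n)+r(n)$ with $0\le r(n)<\ell(n)$ for all $n\ge1$, $m(n)\to\infty$, $\ell(n)/n\to0$ and $r(n)/n\to 0$. (H0) $\ell(n)/s_n^2\to 0$. (Ha) $\displaystyle \frac{\ell(n)}{s_n^2}\sum_{j=1}^{m(n)}\operatorname{Var}\Big(\frac{S_{j\ell(n)}-S_{(j-1)\ell(n)}}{\sqrt{\ell(n)}}\Big)\to 1$. (Hb) $\displaystyle \sup_{1\le j\le m(n)+1}\frac{\ell(n)}{s_n^2}\operatorname{Var}\Big(\frac{S_{j\ell(n)}-S_{(j-1)\ell(n)}}{\sqrt{\ell(n)}}\Big)\to 0$. (Hc) $\mathbb E|X_j|^{2+\delta}<\infty$ for all $j\ge1$, and $\displaystyle \frac{\ell(n)^{(2+\delta)/2}}{s_n^{2+\delta}}\sum_{j=1}^{m(n)}\mathbb E\Big|\frac{S_{j\ell(n)}-S_{(j-1)\ell(n)}}{\sqrt{\ell(n)}}\Big|^{2+\delta}\to 0$. Then $S_n/s_n\rightsquigarrow\mathcal N(0,1)$ as $n\to\infty$. -/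

import Mathlib

open MeasureTheory ProbabilityTheory Filter Topology

namespace AssocCLT

noncomputable section

/-- A finite family `(X_1, …, X_n)` of real random variables is associated if
`Cov(h(X_1, …, X_n), g(X_1, …, X_n)) ≥ 0` for all coordinatewise non-decreasing (Borel) functions
`h`, `g` on `ℝⁿ` for which this covariance exists, i.e. for which `h(X)`, `g(X)` and `h(X) g(X)`
are integrable. -/
def IsAssociatedFin {Ω : Type*} [MeasurableSpace Ω] (P : Measure Ω) {n : ℕ}
    (X : Fin n → Ω → ℝ) : Prop :=
  ∀ h g : (Fin n → ℝ) → ℝ, Monotone h → Monotone g → Measurable h → Measurable g →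
    Integrable (fun ω => h (fun i => X i ω)) P →
    Integrable (fun ω => g (fun i => X i ω)) P →
    Integrable (fun ω => h (fun i => X i ω) * g (fun i => X i ω)) P →
    0 ≤ cov[fun ω => h (fun i => X i ω), fun ω => g (fun i => X i ω); P]

/-- An infinite sequence is associated if all its finite subsequences are associated. -/
def IsAssociated {Ω : Type*} [MeasurableSpace Ω] (P : Measure Ω) (X : ℕ → Ω → ℝ) : Prop :=
  ∀ (n : ℕ) (k : Fin n → ℕ), StrictMono k → IsAssociatedFin P (fun i => X (k i))

/-- (Strict) stationarity: every shift of the sequence has the same law, on the space of real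
sequences, as the sequence itself. -/
def IsStationarySeq {Ω : Type*} [MeasurableSpace Ω] (P : Measure Ω) (X : ℕ → Ω → ℝ) : Prop :=
  ∀ k : ℕ, IdentDistrib (fun ω (i : ℕ) => X (i + k) ω) (fun ω (i : ℕ) => X i ω) P P

/-- `S_n = X_1 + ⋯ + X_n`. Sequences are indexed from `0` in Lean, so `X i` is `X_{i+1}`. -/
def partialSum {Ω : Type*} (X : ℕ → Ω → ℝ) (n : ℕ) (ω : Ω) : ℝ :=
  ∑ i ∈ Finset.range n, X i ω

/-- `s_n`, the standard deviation of `S_n`. -/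
def sd {Ω : Type*} [MeasurableSpace Ω] (P : Measure Ω) (X : ℕ → Ω → ℝ) (n : ℕ) : ℝ :=
  √(Var[partialSum X n; P])

/-- `σ² = Var X_1 + 2 ∑_{j ≥ 2} Cov(X_1, X_j)`. -/
def asymptoticVariance {Ω : Type*} [MeasurableSpace Ω] (P : Measure Ω) (X : ℕ → Ω → ℝ) : ℝ :=
  Var[X 0; P] + 2 * ∑' j : ℕ, cov[X 0, X (j + 1); P]

/-- The normalized block sum `(S_{(j+1)ℓ} - S_{jℓ}) / √ℓ`; the index `j = 0, 1, …` here is the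
block number `j + 1 = 1, 2, …`. -/
def block {Ω : Type*} (X : ℕ → Ω → ℝ) (ℓ j : ℕ) (ω : Ω) : ℝ :=
  (partialSum X ((j + 1) * ℓ) ω - partialSum X (j * ℓ) ω) / √(ℓ : ℝ)

/-- Condition (L): `n = m(n) ℓ(n) + r(n)` with `ℓ(n) ≥ 1`, `0 ≤ r(n) < ℓ(n)`, `m(n) → ∞`,
`ℓ(n)/n → 0` and `r(n)/n → 0`. -/
structure CondL (ℓ m r : ℕ → ℕ) : Prop where
  pos : ∀ n, 1 ≤ n → 0 < ℓ n
  decomp : ∀ n, 1 ≤ n → n = m n * ℓ n + r n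
  rem_lt : ∀ n, 1 ≤ n → r n < ℓ n
  tendsto_m : Tendsto m atTop atTop
  tendsto_l : Tendsto (fun n => (ℓ n : ℝ) / n) atTop (𝓝 0)
  tendsto_r : Tendsto (fun n => (r n : ℝ) / n) atTop (𝓝 0)

/-- Condition (H0): `ℓ(n) / s_n² → 0`. -/
def CondH0 {Ω : Type*} [MeasurableSpace Ω] (P : Measure Ω) (X : ℕ → Ω → ℝ) (ℓ : ℕ → ℕ) : Prop :=
  Tendsto (fun n => (ℓ n : ℝ) / sd P X n ^ 2) atTop (𝓝 0)

/-- Condition (Ha): `(ℓ(n)/s_n²) ∑_{j=1}^{m(n)} Var((S_{jℓ} - S_{(j-1)ℓ})/√ℓ) → 1`. -/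
def CondHa {Ω : Type*} [MeasurableSpace Ω] (P : Measure Ω) (X : ℕ → Ω → ℝ) (ℓ m : ℕ → ℕ) : Prop :=
  Tendsto (fun n => (ℓ n : ℝ) / sd P X n ^ 2 *
    ∑ j ∈ Finset.range (m n), Var[block X (ℓ n) j; P]) atTop (𝓝 1)

/-- Condition (Hb): `sup_{1 ≤ j ≤ m(n)+1} (ℓ(n)/s_n²) Var((S_{jℓ} - S_{(j-1)ℓ})/√ℓ) → 0`. -/
def CondHb {Ω : Type*} [MeasurableSpace Ω] (P : Measure Ω) (X : ℕ → Ω → ℝ) (ℓ m : ℕ → ℕ) : Prop :=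
  Tendsto (fun n => ⨆ j : Fin (m n + 1),
    (ℓ n : ℝ) / sd P X n ^ 2 * Var[block X (ℓ n) j; P]) atTop (𝓝 0)

/-- Condition (Hc) with exponent `2 + δ`: `E|X_j|^{2+δ} < ∞` for all `j`, and the Lyapounov
condition `(ℓ(n)^{(2+δ)/2} / s_n^{2+δ}) ∑_{j=1}^{m(n)} E|(S_{jℓ} - S_{(j-1)ℓ})/√ℓ|^{2+δ} → 0`. -/
structure CondHc {Ω : Type*} [MeasurableSpace Ω] (P : Measure Ω) (X : ℕ → Ω → ℝ) (ℓ m : ℕ → ℕ)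
    (δ : ℝ) : Prop where
  integrable : ∀ j, Integrable (fun ω => |X j ω| ^ (2 + δ)) P
  lyapounov : Tendsto (fun n => (ℓ n : ℝ) ^ ((2 + δ) / 2) / sd P X n ^ (2 + δ) *
    ∑ j ∈ Finset.range (m n), ∫ ω, |block X (ℓ n) j ω| ^ (2 + δ) ∂P) atTop (𝓝 0)

end

end AssocCLT

namespace AssocCLT

/-! ### Estimates for characteristic functions -/

section CharFun

/-! Both limit theorems come from one quantitative bound on characteristic functions,
`IsAssociated.norm_charFun_sub_exp_le`, combined with Lévy's continuity theorem.

Association forces uncorrelated sums to be nearly independent in a measurable way: if `F` and `G`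
are `K`-Lipschitz, then `K * x + F x` and `K * x + G x` are non-decreasing, and this yields
|Cov(F(S_A), G(S_B))| ≤ K² Cov(S_A, S_B) (`IsAssociated.abs_cov_comp_le`). Applied to sines and
cosines, it bounds the failure of the characteristic function of S_A + S_B to factorize. Summed over
consecutive blocks, the errors telescope to 2s²(Var S − ∑ Var(block)), which is Newman's inequality.
Each block factor is then replaced by the Gaussian one with the same variance, at the cost of a
Taylor remainder, and the incomplete last block is dropped by an L¹ estimate.

Part (2) takes s = t / s_n: (Ha) removes the covariance defect, (Hb) the incomplete block and the
fourth-order term, (Hc) the Taylor remainder. Part (1) fixes the block length ℓ and lets n → ∞,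
which leaves a defect of order σ² − Var(S_ℓ)/ℓ; this vanishes as ℓ → ∞ by a Cesàro argument. -/

lemma norm_exp_ofReal_mul_I_sub_quadratic_le (x : ℝ) :
    ‖Complex.exp (x * Complex.I) - (1 + x * Complex.I - x ^ 2 / 2)‖
      ≤ 3 * min (x ^ 2) (|x| ^ 3) := by
  -- Below 1 the minimum is the cube and Taylor's formula applies; above 1 it is the square, and the
  -- terms are bounded separately by |x| + |x| + x²/2 ≤ 3x². The cube gives smallness, while the
  -- square keeps the bound integrable under second moments alone.
  rcases le_total |x| 1 with hx | hx
  · have h := Complex.exp_bound (x := x * Complex.I) (by simpa using hx) (n := 3) (by norm_num)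
    have he : ∑ m ∈ Finset.range 3, ((x : ℂ) * Complex.I) ^ m / (m.factorial : ℂ)
        = 1 + x * Complex.I - x ^ 2 / 2 := by
      simp [Finset.sum_range_succ, mul_pow]
      ring
    rw [he] at h
    have hn : ‖(x : ℂ) * Complex.I‖ = |x| := by simp
    rw [hn] at h
    have h3 : |x| ^ 3 ≤ x ^ 2 := by
      rw [← sq_abs x]
      exact pow_le_pow_of_le_one (abs_nonneg x) hx (by norm_num)
    rw [min_eq_right h3]
    refine h.trans ?_
    norm_num [Nat.factorial]
    nlinarith [pow_nonneg (abs_nonneg x) 3]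
  · have h3 : x ^ 2 ≤ |x| ^ 3 := by
      rw [← sq_abs x]
      exact pow_le_pow_right₀ hx (by norm_num)
    rw [min_eq_left h3]
    have h1 : ‖Complex.exp (x * Complex.I) - 1‖ ≤ |x| := by
      rw [mul_comm]
      simpa using Real.norm_exp_I_mul_ofReal_sub_one_le (x := x)
    have h2 : ‖(x : ℂ) * Complex.I‖ = |x| := by simp
    have h4 : ‖(x : ℂ) ^ 2 / 2‖ = x ^ 2 / 2 := by simp
    calc ‖Complex.exp (x * Complex.I) - (1 + x * Complex.I - x ^ 2 / 2)‖
        = ‖(Complex.exp (x * Complex.I) - 1) - x * Complex.I + (x : ℂ) ^ 2 / 2‖ := by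
          congr 1; ring
      _ ≤ |x| + |x| + x ^ 2 / 2 := by
          refine (norm_add_le _ _).trans (add_le_add ((norm_sub_le _ _).trans ?_) h4.le)
          exact add_le_add h1 h2.le
      _ ≤ 3 * x ^ 2 := by
          rw [← sq_abs x]
          nlinarith

lemma abs_exp_neg_sub_one_sub_le {u : ℝ} (hu : 0 ≤ u) : |Real.exp (-u) - (1 - u)| ≤ u ^ 2 := by
  rcases le_total u 1 with h | h
  · have := Real.abs_exp_sub_one_sub_id_le (x := -u) (by rwa [abs_neg, abs_of_nonneg hu])
    rw [neg_sq] at this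
    convert this using 2
    ring
  · rw [abs_of_nonneg (by linarith [Real.one_sub_le_exp_neg u])]
    have : Real.exp (-u) ≤ 1 := Real.exp_le_one_iff.2 (by linarith)
    nlinarith

/-- The factors are exchanged one at a time; those left in place have norm at most 1. -/
lemma norm_prod_sub_prod_le {ι : Type*} (s : Finset ι) (z w : ι → ℂ)
    (hz : ∀ i ∈ s, ‖z i‖ ≤ 1) (hw : ∀ i ∈ s, ‖w i‖ ≤ 1) :
    ‖∏ i ∈ s, z i - ∏ i ∈ s, w i‖ ≤ ∑ i ∈ s, ‖z i - w i‖ := by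
  classical
  induction s using Finset.induction_on with
  | empty => simp
  | insert a s ha ih =>
    rw [Finset.prod_insert ha, Finset.prod_insert ha, Finset.sum_insert ha]
    have ih' := ih (fun i hi => hz i (Finset.mem_insert_of_mem hi))
      (fun i hi => hw i (Finset.mem_insert_of_mem hi))
    have hp : ‖∏ i ∈ s, z i‖ ≤ 1 := by
      rw [norm_prod]
      exact Finset.prod_le_one (fun i _ => norm_nonneg _)
        (fun i hi => hz i (Finset.mem_insert_of_mem hi))
    have hwa := hw a (Finset.mem_insert_self a s)
    calc ‖z a * ∏ i ∈ s, z i - w a * ∏ i ∈ s, w i‖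
        = ‖(z a - w a) * ∏ i ∈ s, z i + w a * (∏ i ∈ s, z i - ∏ i ∈ s, w i)‖ := by
          congr 1; ring
      _ ≤ ‖z a - w a‖ * ‖∏ i ∈ s, z i‖ + ‖w a‖ * ‖∏ i ∈ s, z i - ∏ i ∈ s, w i‖ := by
          refine (norm_add_le _ _).trans ?_
          rw [norm_mul, norm_mul]
      _ ≤ ‖z a - w a‖ * 1 + 1 * ∑ i ∈ s, ‖z i - w i‖ := by gcongr
      _ = _ := by ring

variable {Ω : Type*} [MeasurableSpace Ω] {P : Measure Ω}

lemma charFun_map_eq_integral {Y : Ω → ℝ} (hY : AEMeasurable Y P) (s : ℝ) :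
    charFun (P.map Y) s = ∫ ω, Complex.exp ((s * Y ω : ℝ) * Complex.I) ∂P := by
  rw [charFun_apply_real, integral_map hY (by fun_prop)]
  simp

lemma integrable_min_sq_cube {Y : Ω → ℝ} (hY : MemLp Y 2 P) (s : ℝ) :
    Integrable (fun ω => min ((s * Y ω) ^ 2) (|s * Y ω| ^ 3)) P := by
  have hm := hY.1.aemeasurable
  refine Integrable.mono' ((hY.const_mul s).integrable_sq) (by fun_prop) (ae_of_all _ fun ω => ?_)
  rw [Real.norm_of_nonneg (by positivity)]
  exact min_le_left _ _

variable [IsProbabilityMeasure P]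

lemma integrable_exp_mul_I {Y : Ω → ℝ} (hY : AEMeasurable Y P) :
    Integrable (fun ω => Complex.exp ((Y ω : ℝ) * Complex.I)) P := by
  refine Integrable.of_bound (C := 1) (by fun_prop) (ae_of_all _ fun ω => ?_)
  rw [Complex.norm_exp_ofReal_mul_I]

/-- Second-order expansion of a characteristic function, compared with a Gaussian one. -/
lemma norm_charFun_sub_exp_le {Y : Ω → ℝ} (hY : MemLp Y 2 P) (h0 : ∫ ω, Y ω ∂P = 0) (s : ℝ) :
    ‖charFun (P.map Y) s - (Real.exp (-(s ^ 2 * Var[Y; P] / 2)) : ℝ)‖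
      ≤ 3 * ∫ ω, min ((s * Y ω) ^ 2) (|s * Y ω| ^ 3) ∂P + s ^ 4 * Var[Y; P] ^ 2 / 4 := by
  have hm := hY.1.aemeasurable
  have hi1 : Integrable Y P := hY.integrable (by norm_num)
  have hi2 : Integrable (fun ω => Y ω ^ 2) P := hY.integrable_sq
  have hv : Var[Y; P] = ∫ ω, Y ω ^ 2 ∂P := variance_of_integral_eq_zero hm h0
  have hq : ∫ ω, ((1 : ℂ) + (s * Y ω : ℝ) * Complex.I - ((s * Y ω : ℝ) : ℂ) ^ 2 / 2) ∂P
      = ((1 - s ^ 2 * Var[Y; P] / 2 : ℝ) : ℂ) := by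
    have e : ∀ ω, (1 : ℂ) + (s * Y ω : ℝ) * Complex.I - ((s * Y ω : ℝ) : ℂ) ^ 2 / 2
        = ((1 - s ^ 2 / 2 * Y ω ^ 2 : ℝ) : ℂ) + ((s * Y ω : ℝ) : ℂ) * Complex.I := by
      intro ω; push_cast; ring
    simp_rw [e]
    rw [integral_add (by exact (((integrable_const _).sub (hi2.const_mul _)).ofReal))
      (by exact ((hi1.const_mul s).ofReal).mul_const _), integral_mul_const,
      integral_complex_ofReal, integral_complex_ofReal, integral_const_mul, h0,
      integral_sub (integrable_const _) (hi2.const_mul _), integral_const_mul, hv]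
    simp
    ring
  have hiq : Integrable
      (fun ω => (1 : ℂ) + (s * Y ω : ℝ) * Complex.I - ((s * Y ω : ℝ) : ℂ) ^ 2 / 2) P := by
    have h2 : Integrable (fun ω => ((s * Y ω : ℝ) : ℂ) ^ 2) P := by
      have := ((hY.const_mul s).integrable_sq).ofReal (𝕜 := ℂ)
      simpa using this
    exact (((integrable_const _).add (((hi1.const_mul s).ofReal).mul_const _))).sub
      (h2.div_const _)
  have hA : ‖charFun (P.map Y) s - ((1 - s ^ 2 * Var[Y; P] / 2 : ℝ) : ℂ)‖
      ≤ 3 * ∫ ω, min ((s * Y ω) ^ 2) (|s * Y ω| ^ 3) ∂P := by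
    rw [charFun_map_eq_integral hm, ← hq,
      ← integral_sub (integrable_exp_mul_I (hm.const_mul s)) hiq, ← integral_const_mul]
    refine norm_integral_le_of_norm_le ((integrable_min_sq_cube hY s).const_mul 3)
      (ae_of_all _ fun ω => ?_)
    exact norm_exp_ofReal_mul_I_sub_quadratic_le _
  have hu : 0 ≤ s ^ 2 * Var[Y; P] / 2 := by
    have := variance_nonneg Y P
    positivity
  have hB := abs_exp_neg_sub_one_sub_le hu
  calc _ = ‖(charFun (P.map Y) s - ((1 - s ^ 2 * Var[Y; P] / 2 : ℝ) : ℂ))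
        - ((Real.exp (-(s ^ 2 * Var[Y; P] / 2)) - (1 - s ^ 2 * Var[Y; P] / 2) : ℝ) : ℂ)‖ := by
          congr 1; push_cast; ring
    _ ≤ 3 * ∫ ω, min ((s * Y ω) ^ 2) (|s * Y ω| ^ 3) ∂P + (s ^ 2 * Var[Y; P] / 2) ^ 2 := by
          refine (norm_sub_le _ _).trans (add_le_add hA ?_)
          rw [Complex.norm_real]
          exact hB
    _ = _ := by ring

/-- Cauchy–Schwarz, read off from the non-negativity of the variance of |Y|. -/
lemma integral_abs_le_sqrt_variance {Y : Ω → ℝ} (hY : MemLp Y 2 P) (h0 : ∫ ω, Y ω ∂P = 0) :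
    ∫ ω, |Y ω| ∂P ≤ √(Var[Y; P]) := by
  have h := variance_nonneg (fun ω => |Y ω|) P
  rw [variance_eq_sub (by simpa using hY.norm)] at h
  have hv : Var[Y; P] = ∫ ω, Y ω ^ 2 ∂P := variance_of_integral_eq_zero hY.1.aemeasurable h0
  have he : P[(fun ω => |Y ω|) ^ 2] = ∫ ω, Y ω ^ 2 ∂P := by simp [sq_abs]
  rw [he, ← hv] at h
  exact Real.le_sqrt_of_sq_le (by linarith)

/-- This discards the incomplete last block. It rests on |e^{ix} − 1| ≤ |x| and needs no relation
between `Y` and `Z`. -/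
lemma norm_charFun_add_sub_le {Y Z : Ω → ℝ} (hY : AEMeasurable Y P) (hZ : MemLp Z 2 P)
    (h0 : ∫ ω, Z ω ∂P = 0) (s : ℝ) :
    ‖charFun (P.map (fun ω => Y ω + Z ω)) s - charFun (P.map Y) s‖ ≤ |s| * √(Var[Z; P]) := by
  have hm := hZ.1.aemeasurable
  have hYZ : AEMeasurable (fun ω => Y ω + Z ω) P := hY.add hm
  rw [charFun_map_eq_integral hYZ, charFun_map_eq_integral hY,
    ← integral_sub (integrable_exp_mul_I (hYZ.const_mul s))
      (integrable_exp_mul_I (hY.const_mul s))]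
  calc _ ≤ ∫ ω, |s| * |Z ω| ∂P := by
        refine norm_integral_le_of_norm_le
          ((hZ.integrable (by norm_num)).abs.const_mul _) (ae_of_all _ fun ω => ?_)
        have e : Complex.exp ((s * (Y ω + Z ω) : ℝ) * Complex.I)
            - Complex.exp ((s * Y ω : ℝ) * Complex.I)
            = Complex.exp ((s * Y ω : ℝ) * Complex.I)
              * (Complex.exp (Complex.I * (s * Z ω : ℝ)) - 1) := by
          rw [mul_sub, ← Complex.exp_add, mul_one]
          push_cast
          ring_nf
        rw [e, norm_mul, Complex.norm_exp_ofReal_mul_I, one_mul, ← abs_mul]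
        exact Real.norm_exp_I_mul_ofReal_sub_one_le
    _ ≤ _ := by
        rw [integral_const_mul]
        exact mul_le_mul_of_nonneg_left (integral_abs_le_sqrt_variance hZ h0) (abs_nonneg s)

end CharFun

/-! ### Sums over finite index sets of an associated sequence -/

/-- The sum of `X i` over a finite set of indices. -/
def indexSum {Ω : Type*} (X : ℕ → Ω → ℝ) (A : Finset ℕ) (ω : Ω) : ℝ := ∑ i ∈ A, X i ω

lemma indexSum_union {Ω : Type*} {X : ℕ → Ω → ℝ} {A B : Finset ℕ} (h : Disjoint A B) :
    indexSum X (A ∪ B) = fun ω => indexSum X A ω + indexSum X B ω := by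
  funext ω
  exact Finset.sum_union h

section Association

variable {Ω : Type*} [MeasurableSpace Ω] {P : Measure Ω} {X : ℕ → Ω → ℝ}

lemma measurable_indexSum (hX : ∀ i, Measurable (X i)) (A : Finset ℕ) :
    Measurable (indexSum X A) :=
  Finset.measurable_fun_sum _ fun i _ => hX i

lemma memLp_indexSum (hX : ∀ i, MemLp (X i) 2 P) (A : Finset ℕ) : MemLp (indexSum X A) 2 P :=
  memLp_finsetSum _ fun i _ => hX i

variable [IsProbabilityMeasure P]

lemma integral_indexSum (hX : ∀ i, MemLp (X i) 2 P) (h0 : ∀ i, ∫ ω, X i ω ∂P = 0)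
    (A : Finset ℕ) : ∫ ω, indexSum X A ω ∂P = 0 := by
  unfold indexSum
  rw [integral_finsetSum _ fun i _ => (hX i).integrable (by norm_num)]
  simp [h0]

/-- Non-decreasing functions of sums of an associated sequence are non-negatively correlated. -/
lemma IsAssociated.cov_comp_nonneg (h : IsAssociated P X) (A B : Finset ℕ) {F G : ℝ → ℝ}
    (hF : Monotone F) (hG : Monotone G) (hFA : MemLp (fun ω => F (indexSum X A ω)) 2 P)
    (hGB : MemLp (fun ω => G (indexSum X B ω)) 2 P) :
    0 ≤ cov[fun ω => F (indexSum X A ω), fun ω => G (indexSum X B ω); P] := by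
  -- Association concerns two functions of the same vector, so both sums are written as
  -- non-decreasing functions of the first `N` variables, with 0/1 coefficients.
  obtain ⟨N, hN⟩ := (A ∪ B).exists_nat_subset_range
  have key : ∀ (C : Finset ℕ), C ⊆ A ∪ B → ∀ ω,
      indexSum X C ω = ∑ i : Fin N, if (i : ℕ) ∈ C then X i ω else 0 := by
    intro C hC ω
    rw [Fin.sum_univ_eq_sum_range (fun i => if i ∈ C then X i ω else 0) N, ← Finset.sum_filter]
    refine Finset.sum_congr ?_ fun _ _ => rfl
    ext i
    simp only [Finset.mem_filter, iff_and_self]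
    exact fun hi => hN (hC hi)
  have mono : ∀ C : Finset ℕ,
      Monotone fun x : Fin N → ℝ => ∑ i : Fin N, if (i : ℕ) ∈ C then x i else 0 := by
    intro C x y hxy
    refine Finset.sum_le_sum fun i _ => ?_
    split_ifs
    · exact hxy i
    · exact le_rfl
  have meas : ∀ C : Finset ℕ,
      Measurable fun x : Fin N → ℝ => ∑ i : Fin N, if (i : ℕ) ∈ C then x i else 0 := by
    intro C
    refine Finset.measurable_fun_sum _ fun i _ => ?_
    split_ifs <;> fun_prop
  have hA := key A Finset.subset_union_left
  have hB := key B Finset.subset_union_right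
  simp_rw [hA] at hFA ⊢
  simp_rw [hB] at hGB ⊢
  exact h N (fun i => (i : ℕ)) Fin.val_strictMono _ _ (hF.comp (mono A)) (hG.comp (mono B))
    (hF.measurable.comp (meas A)) (hG.measurable.comp (meas B))
    (hFA.integrable (by norm_num)) (hGB.integrable (by norm_num)) (hFA.integrable_mul hGB)

lemma IsAssociated.cov_indexSum_nonneg (h : IsAssociated P X) (hX : ∀ i, MemLp (X i) 2 P)
    (A B : Finset ℕ) : 0 ≤ cov[indexSum X A, indexSum X B; P] :=
  h.cov_comp_nonneg A B monotone_id monotone_id (memLp_indexSum hX A) (memLp_indexSum hX B)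

/-- A linear term of slope `K` outweighs any decrease of a `K`-Lipschitz function, which brings
Lipschitz functions within reach of association. -/
lemma monotone_mul_add_of_abs_sub_le {F : ℝ → ℝ} {K : ℝ}
    (hF : ∀ x y, |F x - F y| ≤ K * |x - y|) : Monotone fun x => K * x + F x := by
  intro x y hxy
  have h := hF x y
  rw [abs_sub_comm x y, abs_of_nonneg (sub_nonneg.2 hxy)] at h
  have := (abs_le.1 h).2
  dsimp only
  linarith

/-- Covariances of Lipschitz functions of sums are controlled by the covariance of the sums. -/
lemma IsAssociated.abs_cov_comp_le (h : IsAssociated P X) (hX : ∀ i, MemLp (X i) 2 P)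
    (A B : Finset ℕ) {F G : ℝ → ℝ} {K : ℝ} (hF : ∀ x y, |F x - F y| ≤ K * |x - y|)
    (hG : ∀ x y, |G x - G y| ≤ K * |x - y|) (hFA : MemLp (fun ω => F (indexSum X A ω)) 2 P)
    (hGB : MemLp (fun ω => G (indexSum X B ω)) 2 P) :
    |cov[fun ω => F (indexSum X A ω), fun ω => G (indexSum X B ω); P]|
      ≤ K ^ 2 * cov[indexSum X A, indexSum X B; P] := by
  -- Bilinear expansion of Cov(K S_A + F', K S_B + G') ≥ 0. It is used for the four sign choices
  -- (±F, ±G): adding the two with equal signs cancels the mixed terms and gives the lower bound,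
  -- adding the two with opposite signs gives the upper bound.
  have expand : ∀ F' G' : ℝ → ℝ, (∀ x y, |F' x - F' y| ≤ K * |x - y|) →
      (∀ x y, |G' x - G' y| ≤ K * |x - y|) → MemLp (fun ω => F' (indexSum X A ω)) 2 P →
      MemLp (fun ω => G' (indexSum X B ω)) 2 P →
      0 ≤ K ^ 2 * cov[indexSum X A, indexSum X B; P]
        + K * cov[indexSum X A, fun ω => G' (indexSum X B ω); P]
        + K * cov[fun ω => F' (indexSum X A ω), indexSum X B; P]
        + cov[fun ω => F' (indexSum X A ω), fun ω => G' (indexSum X B ω); P] := by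
    intro F' G' hF' hG' hFA' hGB'
    have hA := (memLp_indexSum hX A).const_mul K
    have hB := (memLp_indexSum hX B).const_mul K
    have h1 := h.cov_comp_nonneg A B (monotone_mul_add_of_abs_sub_le hF')
      (monotone_mul_add_of_abs_sub_le hG') (hA.add hFA') (hB.add hGB')
    have e1 := covariance_add_left hA hFA' (hB.add hGB')
    have e2 := covariance_add_right hA hB hGB'
    have e3 := covariance_add_right hFA' hB hGB'
    change 0 ≤ cov[(fun ω => K * indexSum X A ω) + fun ω => F' (indexSum X A ω),
      (fun ω => K * indexSum X B ω) + fun ω => G' (indexSum X B ω); P] at h1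
    rw [e1, e2, e3] at h1
    simp only [covariance_const_mul_left, covariance_const_mul_right] at h1
    linarith
  have neg : ∀ {F' : ℝ → ℝ}, (∀ x y, |F' x - F' y| ≤ K * |x - y|) →
      ∀ x y, |-F' x - -F' y| ≤ K * |x - y| := by
    intro F' hF' x y
    rw [neg_sub_neg, abs_sub_comm]
    exact hF' x y
  have h1 := expand F G hF hG hFA hGB
  have h2 := expand _ _ (neg hF) (neg hG) hFA.neg hGB.neg
  have h3 := expand F _ hF (neg hG) hFA hGB.neg
  have h4 := expand _ G (neg hF) hG hFA.neg hGB
  simp only [covariance_fun_neg_left, covariance_fun_neg_right] at h2 h3 h4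
  rw [abs_le]
  constructor <;> linarith

/-- The added terms are non-negatively correlated with the old ones. This compares the incomplete
block with a full one, and the full blocks with the whole sum. -/
lemma IsAssociated.variance_indexSum_mono (h : IsAssociated P X) (hX : ∀ i, MemLp (X i) 2 P)
    {A B : Finset ℕ} (hAB : A ⊆ B) : Var[indexSum X A; P] ≤ Var[indexSum X B; P] := by
  rw [← Finset.union_sdiff_of_subset hAB, indexSum_union Finset.disjoint_sdiff,
    variance_fun_add (memLp_indexSum hX A) (memLp_indexSum hX _)]
  have := h.cov_indexSum_nonneg hX A (B \ A)
  have := variance_nonneg (indexSum X (B \ A)) P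
  linarith

lemma charFun_map_eq_re_add_im {Y : Ω → ℝ} (hY : AEMeasurable Y P) (s : ℝ) :
    charFun (P.map Y) s = ((∫ ω, Real.cos (s * Y ω) ∂P : ℝ) : ℂ)
      + ((∫ ω, Real.sin (s * Y ω) ∂P : ℝ) : ℂ) * Complex.I := by
  have hc : Integrable (fun ω => Real.cos (s * Y ω)) P :=
    Integrable.of_bound (C := 1) (by fun_prop) (ae_of_all _ fun ω => Real.abs_cos_le_one _)
  have hs : Integrable (fun ω => Real.sin (s * Y ω)) P :=
    Integrable.of_bound (C := 1) (by fun_prop) (ae_of_all _ fun ω => Real.abs_sin_le_one _)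
  rw [charFun_map_eq_integral hY, ← integral_complex_ofReal, ← integral_complex_ofReal,
    ← integral_mul_const, ← integral_add (by exact hc.ofReal) (by exact hs.ofReal.mul_const _)]
  simp_rw [Complex.exp_mul_I, Complex.ofReal_cos, Complex.ofReal_sin]

/-- The characteristic function of the sum of two disjoint blocks nearly factorizes. -/
lemma IsAssociated.norm_charFun_union_sub_mul_le (h : IsAssociated P X)
    (hm : ∀ i, Measurable (X i)) (hX : ∀ i, MemLp (X i) 2 P) {A B : Finset ℕ}
    (hAB : Disjoint A B) (s : ℝ) :
    ‖charFun (P.map (indexSum X (A ∪ B))) s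
        - charFun (P.map (indexSum X A)) s * charFun (P.map (indexSum X B)) s‖
      ≤ 4 * s ^ 2 * cov[indexSum X A, indexSum X B; P] := by
  have mA := measurable_indexSum hm A
  have mB := measurable_indexSum hm B
  have lc : ∀ x y, |Real.cos (s * x) - Real.cos (s * y)| ≤ |s| * |x - y| := by
    intro x y
    rw [← abs_mul, mul_sub]
    exact Real.abs_cos_sub_cos_le _ _
  have ls : ∀ x y, |Real.sin (s * x) - Real.sin (s * y)| ≤ |s| * |x - y| := by
    intro x y
    rw [← abs_mul, mul_sub]
    exact Real.abs_sin_sub_sin_le _ _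
  have mc : ∀ C, MemLp (fun ω => Real.cos (s * indexSum X C ω)) 2 P := fun C =>
    have := measurable_indexSum hm C
    MemLp.of_bound (by fun_prop) 1 (ae_of_all _ fun ω => Real.abs_cos_le_one _)
  have ms : ∀ C, MemLp (fun ω => Real.sin (s * indexSum X C ω)) 2 P := fun C =>
    have := measurable_indexSum hm C
    MemLp.of_bound (by fun_prop) 1 (ae_of_all _ fun ω => Real.abs_sin_le_one _)
  have cc := h.abs_cov_comp_le hX A B lc lc (mc A) (mc B)
  have ss := h.abs_cov_comp_le hX A B ls ls (ms A) (ms B)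
  have cs := h.abs_cov_comp_le hX A B lc ls (mc A) (ms B)
  have sc := h.abs_cov_comp_le hX A B ls lc (ms A) (mc B)
  rw [sq_abs, covariance_eq_sub (mc A) (mc B)] at cc
  rw [sq_abs, covariance_eq_sub (ms A) (ms B)] at ss
  rw [sq_abs, covariance_eq_sub (mc A) (ms B)] at cs
  rw [sq_abs, covariance_eq_sub (ms A) (mc B)] at sc
  simp only [Pi.mul_apply] at cc ss cs sc
  -- By the addition formulas, the real and imaginary parts of the factorization defect are each a
  -- combination of two covariances of sines and cosines. Each of these is at most s² Cov(S_A, S_B),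
  -- whence the constant 4.
  have hcos : ∫ ω, Real.cos (s * indexSum X (A ∪ B) ω) ∂P
      = ∫ ω, Real.cos (s * indexSum X A ω) * Real.cos (s * indexSum X B ω) ∂P
        - ∫ ω, Real.sin (s * indexSum X A ω) * Real.sin (s * indexSum X B ω) ∂P := by
    rw [← integral_sub (by exact (mc A).integrable_mul (mc B))
      (by exact (ms A).integrable_mul (ms B))]
    simp_rw [indexSum_union hAB, mul_add, Real.cos_add]
  have hsin : ∫ ω, Real.sin (s * indexSum X (A ∪ B) ω) ∂P
      = ∫ ω, Real.sin (s * indexSum X A ω) * Real.cos (s * indexSum X B ω) ∂P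
        + ∫ ω, Real.cos (s * indexSum X A ω) * Real.sin (s * indexSum X B ω) ∂P := by
    rw [← integral_add (by exact (ms A).integrable_mul (mc B))
      (by exact (mc A).integrable_mul (ms B))]
    simp_rw [indexSum_union hAB, mul_add, Real.sin_add]
  rw [charFun_map_eq_re_add_im (measurable_indexSum hm _).aemeasurable,
    charFun_map_eq_re_add_im mA.aemeasurable, charFun_map_eq_re_add_im mB.aemeasurable,
    hcos, hsin]
  refine (Complex.norm_le_abs_re_add_abs_im _).trans ?_
  simp only [Complex.sub_re, Complex.add_re, Complex.mul_re, Complex.sub_im, Complex.add_im,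
    Complex.mul_im, Complex.ofReal_re, Complex.ofReal_im, Complex.I_re, Complex.I_im]
  rw [abs_le] at cc ss cs sc
  refine (add_le_add (b := 2 * (s ^ 2 * cov[indexSum X A, indexSum X B; P]))
    (d := 2 * (s ^ 2 * cov[indexSum X A, indexSum X B; P]))
    (abs_le.2 ⟨?_, ?_⟩) (abs_le.2 ⟨?_, ?_⟩)).trans (le_of_eq (by ring)) <;> linarith

end Association

/-! ### Comparison of a sum over blocks with a Gaussian law -/

/-- The `j`-th block of `ℓ` consecutive indices. -/
def blockIndices (ℓ j : ℕ) : Finset ℕ := Finset.Ico (j * ℓ) ((j + 1) * ℓ)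

lemma range_succ_mul_eq_union (ℓ j : ℕ) :
    Finset.range ((j + 1) * ℓ) = Finset.range (j * ℓ) ∪ blockIndices ℓ j := by
  have : j * ℓ ≤ (j + 1) * ℓ := Nat.mul_le_mul_right _ (Nat.le_succ j)
  ext i
  simp only [blockIndices, Finset.mem_union, Finset.mem_range, Finset.mem_Ico]
  omega

lemma disjoint_range_Ico (a b : ℕ) : Disjoint (Finset.range a) (Finset.Ico a b) := by
  rw [Finset.disjoint_left]
  intro i hi hi'
  simp only [Finset.mem_range, Finset.mem_Ico] at hi hi'
  omega

lemma partialSum_eq_indexSum {Ω : Type*} (X : ℕ → Ω → ℝ) (n : ℕ) :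
    partialSum X n = indexSum X (Finset.range n) := rfl

lemma block_eq_indexSum {Ω : Type*} (X : ℕ → Ω → ℝ) (ℓ j : ℕ) :
    block X ℓ j = fun ω => indexSum X (blockIndices ℓ j) ω / √(ℓ : ℝ) := by
  funext ω
  rw [block, partialSum_eq_indexSum, partialSum_eq_indexSum, range_succ_mul_eq_union,
    indexSum_union (A := Finset.range (j * ℓ)) (B := blockIndices ℓ j) (disjoint_range_Ico _ _),
    add_sub_cancel_left]

section Blocks

variable {Ω : Type*} [MeasurableSpace Ω] {P : Measure Ω} {X : ℕ → Ω → ℝ}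

lemma variance_block {ℓ : ℕ} (hℓ : 0 < ℓ) (j : ℕ) :
    (ℓ : ℝ) * Var[block X ℓ j; P] = Var[indexSum X (blockIndices ℓ j); P] := by
  have hℓ' : (0 : ℝ) < ℓ := Nat.cast_pos.2 hℓ
  simp_rw [block_eq_indexSum, div_eq_mul_inv]
  rw [variance_mul_const, inv_pow, Real.sq_sqrt hℓ'.le]
  field_simp

lemma charFun_map_div {Y : Ω → ℝ} (hY : AEMeasurable Y P) (c t : ℝ) :
    charFun (P.map (fun ω => Y ω / c)) t = charFun (P.map Y) (t / c) := by
  rw [charFun_map_eq_integral (hY.div_const c), charFun_map_eq_integral hY]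
  congr with ω
  rw [div_mul_eq_mul_div, mul_div_assoc]

variable [IsProbabilityMeasure P]

/-- Newman's inequality for consecutive blocks of an associated sequence. -/
lemma IsAssociated.norm_charFun_sub_prod_le (h : IsAssociated P X)
    (hm : ∀ i, Measurable (X i)) (hX : ∀ i, MemLp (X i) 2 P) (ℓ m : ℕ) (s : ℝ) :
    ‖charFun (P.map (indexSum X (Finset.range (m * ℓ)))) s
        - ∏ j ∈ Finset.range m, charFun (P.map (indexSum X (blockIndices ℓ j))) s‖
      ≤ 2 * s ^ 2 * (Var[indexSum X (Finset.range (m * ℓ)); P]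
        - ∑ j ∈ Finset.range m, Var[indexSum X (blockIndices ℓ j); P]) := by
  induction m with
  | zero =>
    have h0 : indexSum X (Finset.range (0 * ℓ)) = fun _ => (0 : ℝ) := by
      funext ω; simp [indexSum]
    rw [h0, charFun_map_eq_integral (by fun_prop)]
    have : Var[fun _ : Ω => (0 : ℝ); P] = 0 := variance_zero P
    simp [this]
  | succ m ih =>
    have hd : Disjoint (Finset.range (m * ℓ)) (blockIndices ℓ m) := disjoint_range_Ico _ _
    have hN := h.norm_charFun_union_sub_mul_le hm hX hd s
    -- Adjoining a block raises the total variance minus the block variances by 2 Cov, so the new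
    -- error 4s² Cov is exactly 2s² times this increment.
    have hv : Var[indexSum X (Finset.range ((m + 1) * ℓ)); P]
        = Var[indexSum X (Finset.range (m * ℓ)); P] + Var[indexSum X (blockIndices ℓ m); P]
          + 2 * cov[indexSum X (Finset.range (m * ℓ)), indexSum X (blockIndices ℓ m); P] := by
      rw [range_succ_mul_eq_union, indexSum_union hd,
        variance_fun_add (memLp_indexSum hX _) (memLp_indexSum hX _)]
      ring
    rw [Finset.prod_range_succ, Finset.sum_range_succ, hv, range_succ_mul_eq_union]
    set φ := charFun (P.map (indexSum X (blockIndices ℓ m))) s with hφ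
    have : IsProbabilityMeasure (P.map (indexSum X (blockIndices ℓ m))) :=
      Measure.isProbabilityMeasure_map (measurable_indexSum hm _).aemeasurable
    have hφ1 : ‖φ‖ ≤ 1 := norm_charFun_le_one s
    set a := charFun (P.map (indexSum X (Finset.range (m * ℓ)))) s
    set b := ∏ j ∈ Finset.range m, charFun (P.map (indexSum X (blockIndices ℓ j))) s
    set c := charFun (P.map (indexSum X (Finset.range (m * ℓ) ∪ blockIndices ℓ m))) s
    calc ‖c - b * φ‖ = ‖(c - a * φ) + (a - b) * φ‖ := by congr 1; ring
      _ ≤ ‖c - a * φ‖ + ‖a - b‖ * 1 := by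
          refine (norm_add_le _ _).trans (add_le_add le_rfl ?_)
          rw [norm_mul]
          exact mul_le_mul_of_nonneg_left hφ1 (norm_nonneg _)
      _ ≤ _ := by rw [mul_one]; linarith

/-- The characteristic function of a sum of an associated sequence, cut into `m` blocks of
length `ℓ` and a shorter remainder, compared with a Gaussian characteristic function. -/
lemma IsAssociated.norm_charFun_sub_exp_le (h : IsAssociated P X)
    (hm : ∀ i, Measurable (X i)) (hX : ∀ i, MemLp (X i) 2 P) (h0 : ∀ i, ∫ ω, X i ω ∂P = 0)
    (ℓ m r : ℕ) (hr : r ≤ ℓ) (s : ℝ) :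
    ‖charFun (P.map (indexSum X (Finset.range (m * ℓ + r)))) s
        - (Real.exp (-(s ^ 2 * (∑ j ∈ Finset.range m, Var[indexSum X (blockIndices ℓ j); P]) / 2))
          : ℝ)‖
      ≤ |s| * √(Var[indexSum X (blockIndices ℓ m); P])
        + 2 * s ^ 2 * (Var[indexSum X (Finset.range (m * ℓ + r)); P]
          - ∑ j ∈ Finset.range m, Var[indexSum X (blockIndices ℓ j); P])
        + 3 * ∑ j ∈ Finset.range m, ∫ ω, min ((s * indexSum X (blockIndices ℓ j) ω) ^ 2)
            (|s * indexSum X (blockIndices ℓ j) ω| ^ 3) ∂P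
        + s ^ 4 / 4 * ∑ j ∈ Finset.range m, Var[indexSum X (blockIndices ℓ j); P] ^ 2 := by
  have hsplit : Finset.range (m * ℓ + r)
      = Finset.range (m * ℓ) ∪ Finset.Ico (m * ℓ) (m * ℓ + r) := by
    ext i
    simp only [Finset.mem_union, Finset.mem_range, Finset.mem_Ico]
    omega
  have hsub : Finset.Ico (m * ℓ) (m * ℓ + r) ⊆ blockIndices ℓ m :=
    Finset.Ico_subset_Ico le_rfl (by rw [Nat.succ_mul]; omega)
  have h1 : ‖charFun (P.map (indexSum X (Finset.range (m * ℓ + r)))) s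
      - charFun (P.map (indexSum X (Finset.range (m * ℓ)))) s‖
      ≤ |s| * √(Var[indexSum X (blockIndices ℓ m); P]) := by
    rw [hsplit, indexSum_union (disjoint_range_Ico _ _)]
    refine (norm_charFun_add_sub_le (measurable_indexSum hm _).aemeasurable
      (memLp_indexSum hX _) (integral_indexSum hX h0 _) s).trans ?_
    exact mul_le_mul_of_nonneg_left (Real.sqrt_le_sqrt (h.variance_indexSum_mono hX hsub))
      (abs_nonneg s)
  have h2 := h.norm_charFun_sub_prod_le hm hX ℓ m s
  -- Monotonicity allows the defect to be stated with the variance of the whole sum, the quantity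
  -- used for normalization.
  have h3 : Var[indexSum X (Finset.range (m * ℓ)); P]
      ≤ Var[indexSum X (Finset.range (m * ℓ + r)); P] :=
    h.variance_indexSum_mono hX (Finset.range_mono (by omega))
  have h4 : ‖∏ j ∈ Finset.range m, charFun (P.map (indexSum X (blockIndices ℓ j))) s
      - (Real.exp (-(s ^ 2 * (∑ j ∈ Finset.range m, Var[indexSum X (blockIndices ℓ j); P]) / 2))
          : ℝ)‖
      ≤ 3 * ∑ j ∈ Finset.range m, ∫ ω, min ((s * indexSum X (blockIndices ℓ j) ω) ^ 2)
            (|s * indexSum X (blockIndices ℓ j) ω| ^ 3) ∂P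
        + s ^ 4 / 4 * ∑ j ∈ Finset.range m, Var[indexSum X (blockIndices ℓ j); P] ^ 2 := by
    have he : Real.exp
        (-(s ^ 2 * (∑ j ∈ Finset.range m, Var[indexSum X (blockIndices ℓ j); P]) / 2))
        = ∏ j ∈ Finset.range m, Real.exp (-(s ^ 2 * Var[indexSum X (blockIndices ℓ j); P] / 2)) := by
      rw [← Real.exp_sum, Finset.sum_neg_distrib, ← Finset.sum_div, ← Finset.mul_sum]
    rw [he, Complex.ofReal_prod]
    refine (norm_prod_sub_prod_le _ _ _ (fun j _ => ?_) (fun j _ => ?_)).trans ?_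
    · have : IsProbabilityMeasure (P.map (indexSum X (blockIndices ℓ j))) :=
        Measure.isProbabilityMeasure_map (measurable_indexSum hm _).aemeasurable
      exact norm_charFun_le_one s
    · rw [Complex.norm_real, Real.norm_of_nonneg (Real.exp_pos _).le, Real.exp_le_one_iff]
      have := variance_nonneg (indexSum X (blockIndices ℓ j)) P
      have : 0 ≤ s ^ 2 * Var[indexSum X (blockIndices ℓ j); P] / 2 := by positivity
      linarith
    · rw [Finset.mul_sum, Finset.mul_sum, ← Finset.sum_add_distrib]
      refine Finset.sum_le_sum fun j _ => ?_
      refine (AssocCLT.norm_charFun_sub_exp_le (memLp_indexSum hX _)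
        (integral_indexSum hX h0 _) s).trans (le_of_eq ?_)
      ring
  have h5 := norm_sub_le_norm_sub_add_norm_sub
    (charFun (P.map (indexSum X (Finset.range (m * ℓ + r)))) s)
    (charFun (P.map (indexSum X (Finset.range (m * ℓ)))) s)
    (Real.exp (-(s ^ 2 * (∑ j ∈ Finset.range m, Var[indexSum X (blockIndices ℓ j); P]) / 2)) : ℝ)
  have h6 := norm_sub_le_norm_sub_add_norm_sub
    (charFun (P.map (indexSum X (Finset.range (m * ℓ)))) s)
    (∏ j ∈ Finset.range m, charFun (P.map (indexSum X (blockIndices ℓ j))) s)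
    (Real.exp (-(s ^ 2 * (∑ j ∈ Finset.range m, Var[indexSum X (blockIndices ℓ j); P]) / 2)) : ℝ)
  have h7 := mul_le_mul_of_nonneg_left h3 (by positivity : 0 ≤ 2 * s ^ 2)
  linarith

/-- Convergence to a centred Gaussian law via characteristic functions. -/
lemma tendstoInDistribution_gaussianReal {Y : ℕ → Ω → ℝ} (hY : ∀ n, Measurable (Y n)) {v : ℝ}
    (hv : 0 ≤ v) (h : ∀ t : ℝ, Tendsto (fun n => charFun (P.map (Y n)) t) atTop
      (𝓝 ((Real.exp (-(t ^ 2 * v / 2)) : ℝ) : ℂ))) :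
    TendstoInDistribution Y atTop (id : ℝ → ℝ) (fun _ => P) (gaussianReal 0 v.toNNReal) where
  forall_aemeasurable n := (hY n).aemeasurable
  tendsto := by
    refine ProbabilityMeasure.tendsto_iff_tendsto_charFun.2 fun t => ?_
    have e : charFun ((gaussianReal 0 v.toNNReal).map (id : ℝ → ℝ)) t
        = ((Real.exp (-(t ^ 2 * v / 2)) : ℝ) : ℂ) := by
      rw [Measure.map_id, charFun_gaussianReal, Real.coe_toNNReal v hv, Complex.ofReal_exp]
      congr 1
      push_cast
      ring
    change Tendsto (fun n => charFun (P.map (Y n)) t) atTop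
      (𝓝 (charFun ((gaussianReal 0 v.toNNReal).map (id : ℝ → ℝ)) t))
    rw [e]
    exact h t

end Blocks

/-! ### The Lyapounov-type theorem -/

section Lyapounov

/-- Truncation at level `ε`: below it the cube is at most ε x², above it (|x|/ε)^δ ≥ 1. This covers
every δ > 0, including δ > 1. -/
lemma min_sq_cube_le {ε δ : ℝ} (hε : 0 < ε) (hδ : 0 < δ) (x : ℝ) :
    min (x ^ 2) (|x| ^ 3) ≤ ε * x ^ 2 + ε ^ (-δ) * |x| ^ (2 + δ) := by
  have h1 : 0 ≤ ε ^ (-δ) * |x| ^ (2 + δ) := by positivity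
  rcases le_or_gt |x| ε with h | h
  · refine (min_le_right _ _).trans ?_
    have : |x| ^ 3 ≤ ε * x ^ 2 := by
      rw [← sq_abs x, pow_succ' _ 2]
      exact mul_le_mul_of_nonneg_right h (by positivity)
    linarith
  · refine (min_le_left _ _).trans ?_
    have hx : 0 < |x| := hε.trans h
    have h2 : 1 ≤ ε ^ (-δ) * |x| ^ δ := by
      rw [Real.rpow_neg hε.le, ← div_eq_inv_mul, one_le_div (by positivity)]
      exact Real.rpow_le_rpow hε.le h.le hδ.le
    have h3 : |x| ^ (2 + δ) = x ^ 2 * |x| ^ δ := by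
      rw [Real.rpow_add hx, Real.rpow_two, sq_abs]
    rw [h3]
    have h4 := mul_le_mul_of_nonneg_left h2 (sq_nonneg x)
    have h5 : 0 ≤ ε * x ^ 2 := by positivity
    linarith

variable {Ω : Type*} [MeasurableSpace Ω] {P : Measure Ω} {X : ℕ → Ω → ℝ}

lemma integral_block_rpow {ℓ : ℕ} (hℓ : 0 < ℓ) (j : ℕ) (δ : ℝ) :
    (ℓ : ℝ) ^ ((2 + δ) / 2) * ∫ ω, |block X ℓ j ω| ^ (2 + δ) ∂P
      = ∫ ω, |indexSum X (blockIndices ℓ j) ω| ^ (2 + δ) ∂P := by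
  have hℓ' : (0 : ℝ) < ℓ := Nat.cast_pos.2 hℓ
  rw [← integral_const_mul]
  congr with ω
  rw [block_eq_indexSum, abs_div, abs_of_nonneg (Real.sqrt_nonneg _),
    Real.div_rpow (abs_nonneg _) (Real.sqrt_nonneg _), Real.sqrt_eq_rpow, ← Real.rpow_mul hℓ'.le,
    one_div_mul_eq_div]
  exact mul_div_cancel₀ _ (Real.rpow_pos_of_pos hℓ' _).ne'

lemma memLp_two_add_of_integrable (hm : ∀ i, Measurable (X i)) {δ : ℝ} (hδ : 0 < δ)
    (hX : ∀ i, Integrable (fun ω => |X i ω| ^ (2 + δ)) P) (i : ℕ) :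
    MemLp (X i) (ENNReal.ofReal (2 + δ)) P := by
  rw [← integrable_norm_rpow_iff (hm i).aestronglyMeasurable
    (by simp only [ne_eq, ENNReal.ofReal_eq_zero, not_le]; linarith) ENNReal.ofReal_ne_top,
    ENNReal.toReal_ofReal (by linarith)]
  exact hX i

lemma integrable_indexSum_rpow (hm : ∀ i, Measurable (X i)) {δ : ℝ} (hδ : 0 < δ)
    (hX : ∀ i, Integrable (fun ω => |X i ω| ^ (2 + δ)) P) (A : Finset ℕ) :
    Integrable (fun ω => |indexSum X A ω| ^ (2 + δ)) P := by
  have h : MemLp (indexSum X A) (ENNReal.ofReal (2 + δ)) P :=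
    memLp_finsetSum _ fun i _ => memLp_two_add_of_integrable hm hδ hX i
  rw [← integrable_norm_rpow_iff (measurable_indexSum hm A).aestronglyMeasurable
    (by simp only [ne_eq, ENNReal.ofReal_eq_zero, not_le]; linarith) ENNReal.ofReal_ne_top,
    ENNReal.toReal_ofReal (by linarith)] at h
  exact h

lemma integral_min_sq_cube_le {Y : Ω → ℝ} (hY : MemLp Y 2 P) (h0 : ∫ ω, Y ω ∂P = 0)
    {ε δ : ℝ} (hε : 0 < ε) (hδ : 0 < δ) (hYδ : Integrable (fun ω => |Y ω| ^ (2 + δ)) P) (s : ℝ) :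
    ∫ ω, min ((s * Y ω) ^ 2) (|s * Y ω| ^ 3) ∂P
      ≤ ε * (s ^ 2 * Var[Y; P]) + ε ^ (-δ) * (|s| ^ (2 + δ) * ∫ ω, |Y ω| ^ (2 + δ) ∂P) := by
  have hv : Var[Y; P] = ∫ ω, Y ω ^ 2 ∂P := variance_of_integral_eq_zero hY.1.aemeasurable h0
  have hi2 : Integrable (fun ω => ε * (s ^ 2 * Y ω ^ 2)) P :=
    (hY.integrable_sq.const_mul _).const_mul _
  have hiδ : Integrable (fun ω => ε ^ (-δ) * (|s| ^ (2 + δ) * |Y ω| ^ (2 + δ))) P :=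
    (hYδ.const_mul _).const_mul _
  rw [hv, ← integral_const_mul, ← integral_const_mul, ← integral_const_mul, ← integral_const_mul,
    ← integral_add hi2 hiδ]
  refine integral_mono (integrable_min_sq_cube hY s) (hi2.add hiδ) fun ω => ?_
  have := min_sq_cube_le hε hδ (s * Y ω)
  rw [mul_pow, abs_mul, Real.mul_rpow (abs_nonneg _) (abs_nonneg _)] at this
  simpa [mul_pow, abs_mul] using this

variable [IsProbabilityMeasure P]

lemma memLp_two_of_integrable (hm : ∀ i, Measurable (X i)) {δ : ℝ} (hδ : 0 < δ)
    (hX : ∀ i, Integrable (fun ω => |X i ω| ^ (2 + δ)) P) (i : ℕ) : MemLp (X i) 2 P := by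
  refine (memLp_two_add_of_integrable hm hδ hX i).mono_exponent ?_
  rw [← ENNReal.ofReal_ofNat 2]
  exact ENNReal.ofReal_le_ofReal (by linarith)

/-- A central limit theorem for associated sequences satisfying a Lyapounov condition on
blocks. -/
theorem IsAssociated.tendstoInDistribution_of_lyapounov (h : IsAssociated P X)
    (hm : ∀ i, Measurable (X i)) (h0 : ∀ i, ∫ ω, X i ω ∂P = 0) {ℓ m r : ℕ → ℕ} {δ : ℝ}
    (hδ : 0 < δ) (hL : CondL ℓ m r) (ha : CondHa P X ℓ m) (hb : CondHb P X ℓ m)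
    (hc : CondHc P X ℓ m δ) :
    TendstoInDistribution (fun (n : ℕ) ω => partialSum X n ω / sd P X n) atTop
      (id : ℝ → ℝ) (fun _ => P) (gaussianReal 0 1) := by
  have hX := memLp_two_of_integrable hm hδ hc.integrable
  rw [← Real.toNNReal_one]
  refine tendstoInDistribution_gaussianReal
    (fun n => (measurable_indexSum hm (Finset.range n)).div_const _) zero_le_one fun t => ?_
  change Tendsto (fun n => charFun (P.map (fun ω => partialSum X n ω / sd P X n)) t) atTop _
  set V : ℕ → ℕ → ℝ := fun n j => Var[indexSum X (blockIndices (ℓ n) j); P] with hV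
  set M : ℕ → ℝ := fun n => ⨆ j : Fin (m n + 1),
    (ℓ n : ℝ) / sd P X n ^ 2 * Var[block X (ℓ n) j; P] with hM
  set W : ℕ → ℝ := fun n => (ℓ n : ℝ) / sd P X n ^ 2 *
    ∑ j ∈ Finset.range (m n), Var[block X (ℓ n) j; P] with hW
  set Λ : ℕ → ℝ := fun n => (ℓ n : ℝ) ^ ((2 + δ) / 2) / sd P X n ^ (2 + δ) *
    ∑ j ∈ Finset.range (m n), ∫ ω, |block X (ℓ n) j ω| ^ (2 + δ) ∂P with hΛ
  set L : ℕ → ℝ := fun n => ∑ j ∈ Finset.range (m n),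
    ∫ ω, min ((t / sd P X n * indexSum X (blockIndices (ℓ n) j) ω) ^ 2)
      (|t / sd P X n * indexSum X (blockIndices (ℓ n) j) ω| ^ 3) ∂P with hLdef
  have tW : Tendsto W atTop (𝓝 1) := ha
  have tM : Tendsto M atTop (𝓝 0) := hb
  have tΛ : Tendsto Λ atTop (𝓝 0) := hc.lyapounov
  -- Where `sd P X n = 0`, division by zero makes `W n = 0`, which is eventually excluded by `W n →
  -- 1`.
  have hsd : ∀ᶠ n in atTop, 0 < sd P X n := by
    filter_upwards [tW.eventually_ne one_ne_zero] with n hn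
    refine lt_of_le_of_ne (Real.sqrt_nonneg _) fun h' => hn ?_
    simp [hW, ← h']
  have hw : ∀ n, 1 ≤ n → ∀ j,
      (ℓ n : ℝ) / sd P X n ^ 2 * Var[block X (ℓ n) j; P] = V n j / sd P X n ^ 2 := by
    intro n hn j
    rw [hV]
    dsimp only
    rw [← variance_block (hL.pos n hn), div_mul_eq_mul_div]
  have hWV : ∀ n, 1 ≤ n → W n = (∑ j ∈ Finset.range (m n), V n j) / sd P X n ^ 2 := by
    intro n hn
    rw [hW]
    dsimp only
    rw [Finset.mul_sum, Finset.sum_div]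
    exact Finset.sum_congr rfl fun j _ => hw n hn j
  -- The case `j = m n` is included: it is the full block containing the incomplete one.
  have hMV : ∀ n, 1 ≤ n → ∀ j ≤ m n, V n j / sd P X n ^ 2 ≤ M n := by
    intro n hn j hj
    rw [← hw n hn j]
    exact le_ciSup (f := fun j : Fin (m n + 1) =>
      (ℓ n : ℝ) / sd P X n ^ 2 * Var[block X (ℓ n) j; P]) (Set.finite_range _).bddAbove
      ⟨j, Nat.lt_succ_of_le hj⟩
  have hV0 : ∀ n j, 0 ≤ V n j := fun n j => variance_nonneg _ _
  have hLle : ∀ ε, 0 < ε → ∀ᶠ n in atTop,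
      L n ≤ ε * (t ^ 2 * W n) + ε ^ (-δ) * (|t| ^ (2 + δ) * Λ n) := by
    intro ε hε
    filter_upwards [hsd, eventually_ge_atTop 1] with n hn hn1
    have e1 : t ^ 2 * W n = ∑ j ∈ Finset.range (m n), (t / sd P X n) ^ 2 * V n j := by
      rw [hWV n hn1, ← Finset.mul_sum, div_pow]
      ring
    have e2 : |t| ^ (2 + δ) * Λ n = ∑ j ∈ Finset.range (m n), |t / sd P X n| ^ (2 + δ)
        * ∫ ω, |indexSum X (blockIndices (ℓ n) j) ω| ^ (2 + δ) ∂P := by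
      rw [hΛ]
      dsimp only
      rw [div_mul_eq_mul_div, abs_div, abs_of_pos hn, Real.div_rpow (abs_nonneg _) hn.le,
        ← Finset.mul_sum, Finset.mul_sum (Finset.range (m n)) _ ((ℓ n : ℝ) ^ ((2 + δ) / 2))]
      simp_rw [integral_block_rpow (hL.pos n hn1)]
      ring
    rw [e1, e2, Finset.mul_sum, Finset.mul_sum, ← Finset.sum_add_distrib]
    exact Finset.sum_le_sum fun j _ => integral_min_sq_cube_le (memLp_indexSum hX _)
      (integral_indexSum hX h0 _) hε hδ (integrable_indexSum_rpow hm hδ hc.integrable _) _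
  have tL : Tendsto L atTop (𝓝 0) := by
    have hL0 : ∀ n, 0 ≤ L n := fun n => Finset.sum_nonneg fun j _ =>
      integral_nonneg fun ω => by positivity
    refine tendsto_order.2 ⟨fun a ha => Eventually.of_forall fun n => ha.trans_le (hL0 n),
      fun η hη => ?_⟩
    -- With this truncation level the limit of the upper bound is η t²/(t² + 1) < η, also when `t =
    -- 0`.
    have hε : 0 < η / (t ^ 2 + 1) := by positivity
    have hlim : Tendsto (fun n => η / (t ^ 2 + 1) * (t ^ 2 * W n)
        + (η / (t ^ 2 + 1)) ^ (-δ) * (|t| ^ (2 + δ) * Λ n)) atTop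
        (𝓝 (η / (t ^ 2 + 1) * (t ^ 2 * 1) + (η / (t ^ 2 + 1)) ^ (-δ) * (|t| ^ (2 + δ) * 0))) :=
      ((tW.const_mul _).const_mul _).add ((tΛ.const_mul _).const_mul _)
    have hlt : η / (t ^ 2 + 1) * (t ^ 2 * 1)
        + (η / (t ^ 2 + 1)) ^ (-δ) * (|t| ^ (2 + δ) * 0) < η := by
      rw [mul_zero, mul_zero, add_zero, mul_one, div_mul_eq_mul_div, div_lt_iff₀ (by positivity)]
      nlinarith
    filter_upwards [hlim.eventually (gt_mem_nhds hlt), hLle _ hε] with n h1 h2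
    exact h2.trans_lt h1
  have hmain : ∀ᶠ n in atTop,
      ‖charFun (P.map (fun ω => partialSum X n ω / sd P X n)) t
        - ((Real.exp (-(t ^ 2 * W n / 2)) : ℝ) : ℂ)‖
      ≤ |t| * √(M n) + 2 * t ^ 2 * (1 - W n) + 3 * L n + t ^ 4 / 4 * (M n * W n) := by
    filter_upwards [hsd, eventually_ge_atTop 1] with n hn hn1
    have key := h.norm_charFun_sub_exp_le hm hX h0 (ℓ n) (m n) (r n) (hL.rem_lt n hn1).le
      (t / sd P X n)
    rw [← hL.decomp n hn1] at key
    rw [charFun_map_div (Y := partialSum X n)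
      (measurable_indexSum hm (Finset.range n)).aemeasurable]
    have e1 : (t / sd P X n) ^ 2 * (∑ j ∈ Finset.range (m n), V n j) = t ^ 2 * W n := by
      rw [hWV n hn1, div_pow]
      ring
    have e2 : |t / sd P X n| * √(V n (m n)) ≤ |t| * √(M n) := by
      rw [abs_div, abs_of_pos hn, div_mul_eq_mul_div, mul_div_assoc]
      refine mul_le_mul_of_nonneg_left ?_ (abs_nonneg t)
      rw [← Real.sqrt_sq hn.le, ← Real.sqrt_div (hV0 _ _)]
      exact Real.sqrt_le_sqrt (hMV n hn1 _ le_rfl)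
    have e3 : (t / sd P X n) ^ 2 * Var[indexSum X (Finset.range n); P] = t ^ 2 := by
      have : sd P X n ^ 2 = Var[indexSum X (Finset.range n); P] :=
        Real.sq_sqrt (variance_nonneg _ _)
      rw [← this, div_pow, div_mul_cancel₀ _ (by positivity)]
    -- In the sum of squared normalized variances, one factor is bounded by the maximum `M n`; the
    -- other factors add up to `W n`.
    have e4 : (t / sd P X n) ^ 4 / 4 * ∑ j ∈ Finset.range (m n), V n j ^ 2
        ≤ t ^ 4 / 4 * (M n * W n) := by
      have : (t / sd P X n) ^ 4 / 4 * ∑ j ∈ Finset.range (m n), V n j ^ 2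
          = t ^ 4 / 4 * ∑ j ∈ Finset.range (m n),
            V n j / sd P X n ^ 2 * (V n j / sd P X n ^ 2) := by
        rw [Finset.mul_sum, Finset.mul_sum]
        refine Finset.sum_congr rfl fun j _ => ?_
        field_simp
      rw [this, hWV n hn1, Finset.sum_div, Finset.mul_sum _ _ (M n)]
      have ht : 0 ≤ t ^ 4 / 4 := by positivity
      refine mul_le_mul_of_nonneg_left (Finset.sum_le_sum fun j hj => ?_) ht
      exact mul_le_mul_of_nonneg_right (hMV n hn1 j (Finset.mem_range.1 hj).le)
        (div_nonneg (hV0 _ _) (sq_nonneg _))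
    rw [e1] at key
    refine key.trans ?_
    have e5 : 2 * (t / sd P X n) ^ 2 * (Var[indexSum X (Finset.range n); P]
        - ∑ j ∈ Finset.range (m n), V n j) = 2 * t ^ 2 * (1 - W n) := by
      rw [mul_assoc, mul_sub, e1, e3]
      ring
    exact add_le_add (add_le_add (add_le_add e2 e5.le) le_rfl) e4
  have tbound : Tendsto (fun n => |t| * √(M n) + 2 * t ^ 2 * (1 - W n) + 3 * L n
      + t ^ 4 / 4 * (M n * W n)) atTop (𝓝 0) := by
    have := (((tM.sqrt.const_mul |t|).add ((tW.const_sub 1).const_mul (2 * t ^ 2))).add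
      (tL.const_mul 3)).add ((tM.mul tW).const_mul (t ^ 4 / 4))
    simpa using this
  have texp : Tendsto (fun n => ((Real.exp (-(t ^ 2 * W n / 2)) : ℝ) : ℂ)) atTop
      (𝓝 ((Real.exp (-(t ^ 2 * 1 / 2)) : ℝ) : ℂ)) :=
    (Complex.continuous_ofReal.tendsto _).comp
      ((Real.continuous_exp.tendsto _).comp (((tW.const_mul _).div_const 2).neg))
  have tdiff := squeeze_zero_norm' hmain tbound
  simpa using tdiff.add texp

end Lyapounov

/-! ### The stationary theorem -/

section Stationary

variable {Ω : Type*} [MeasurableSpace Ω] {P : Measure Ω} {X : ℕ → Ω → ℝ}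

lemma IsStationarySeq.identDistrib (hs : IsStationarySeq P X) (i : ℕ) :
    IdentDistrib (X i) (X 0) P P := by
  have := (hs i).comp (u := fun x : ℕ → ℝ => x 0) (by fun_prop)
  simpa [Function.comp_def] using this

lemma IsStationarySeq.identDistrib_indexSum (hs : IsStationarySeq P X) {a b k : ℕ}
    (hk : b - a = k) :
    IdentDistrib (indexSum X (Finset.Ico a b)) (indexSum X (Finset.range k)) P P := by
  have h := (hs a).comp (u := fun x : ℕ → ℝ => ∑ i ∈ Finset.range k, x i) (by fun_prop)
  suffices e : indexSum X (Finset.Ico a b)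
      = (fun x : ℕ → ℝ => ∑ i ∈ Finset.range k, x i) ∘ fun ω i => X (i + a) ω by
    rw [e]
    exact h
  funext ω
  simp only [indexSum, Function.comp_def, Finset.sum_Ico_eq_sum_range, hk]
  exact Finset.sum_congr rfl fun i _ => by rw [add_comm]

lemma IsStationarySeq.identDistrib_block (hs : IsStationarySeq P X) (ℓ j : ℕ) :
    IdentDistrib (indexSum X (blockIndices ℓ j)) (indexSum X (Finset.range ℓ)) P P :=
  hs.identDistrib_indexSum (by rw [Nat.succ_mul, Nat.add_sub_cancel_left])

/-- Rescaled second-order remainders of a fixed square-integrable variable vanish. -/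
lemma tendsto_mul_integral_min_sq_cube {Y : Ω → ℝ} (hY : MemLp Y 2 P) (t : ℝ) :
    Tendsto (fun n : ℕ => (n : ℝ) * ∫ ω, min ((t / √(n : ℝ) * Y ω) ^ 2)
      (|t / √(n : ℝ) * Y ω| ^ 3) ∂P) atTop (𝓝 0) := by
  have hm := hY.1.aemeasurable
  simp_rw [← integral_const_mul]
  -- The factor `n` cancels the scaling of the square, giving an integrable dominating function, and
  -- leaves 1/√n on the cube, giving pointwise convergence to 0.
  have hle : ∀ (n : ℕ) (ω : Ω), (n : ℝ) * min ((t / √(n : ℝ) * Y ω) ^ 2)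
      (|t / √(n : ℝ) * Y ω| ^ 3) ≤ min ((t * Y ω) ^ 2) (|t * Y ω| ^ 3 / √(n : ℝ)) := by
    intro n ω
    rcases Nat.eq_zero_or_pos n with rfl | hn
    · simp
      positivity
    · have hn' : (0 : ℝ) < √(n : ℝ) := Real.sqrt_pos.2 (Nat.cast_pos.2 hn)
      have hsq : (n : ℝ) = √(n : ℝ) ^ 2 := (Real.sq_sqrt (Nat.cast_nonneg n)).symm
      rw [div_mul_eq_mul_div, abs_div, abs_of_pos hn', mul_min_of_nonneg _ _ (Nat.cast_nonneg n)]
      refine min_le_min (le_of_eq ?_) (le_of_eq ?_)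
      · nth_rewrite 1 [hsq]
        field_simp
      · nth_rewrite 1 [hsq]
        field_simp
  have h0 : (0 : ℝ) = ∫ _, (0 : ℝ) ∂P := by simp
  rw [h0]
  refine tendsto_integral_of_dominated_convergence (fun ω => (t * Y ω) ^ 2)
    (fun n => by fun_prop) ((hY.const_mul t).integrable_sq) (fun n => ae_of_all _ fun ω => ?_)
    (ae_of_all _ fun ω => ?_)
  · rw [Real.norm_of_nonneg (by positivity)]
    exact (hle n ω).trans (min_le_left _ _)
  · refine squeeze_zero (fun n => by positivity)
      (fun n => (hle n ω).trans (min_le_right _ _)) ?_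
    exact tendsto_const_nhds.div_atTop
      (Real.tendsto_sqrt_atTop.comp tendsto_natCast_atTop_atTop)

variable [IsProbabilityMeasure P]

/-- The variances of normalized partial sums converge to the asymptotic variance. -/
lemma IsStationarySeq.tendsto_variance_div (hs : IsStationarySeq P X)
    (hX : ∀ i, MemLp (X i) 2 P)
    (hsum : Summable (fun j : ℕ => cov[X 0, X (j + 1); P])) :
    Tendsto (fun n : ℕ => Var[indexSum X (Finset.range n); P] / n) atTop
      (𝓝 (asymptoticVariance P X)) := by
  set u : ℕ → ℝ := fun n => Var[X 0; P] + 2 * ∑ j ∈ Finset.range n, cov[X 0, X (j + 1); P] with hu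
  have tu : Tendsto u atTop (𝓝 (asymptoticVariance P X)) :=
    (hsum.hasSum.tendsto_sum_nat.const_mul 2).const_add _
  -- The first variable is split off and the rest shifted back by stationarity. The variance of S_n
  -- is thus a sum of the terms `u i`, and dividing by `n` gives their Cesàro mean.
  have hrec : ∀ n, Var[indexSum X (Finset.range (n + 1)); P]
      = Var[indexSum X (Finset.range n); P] + u n := by
    intro n
    have e : indexSum X (Finset.range (n + 1))
        = fun ω => X 0 ω + ∑ j ∈ Finset.range n, X (j + 1) ω := by
      funext ω
      rw [indexSum, Finset.sum_range_succ', add_comm]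
    have e' : (fun ω => ∑ j ∈ Finset.range n, X (j + 1) ω)
        = indexSum X (Finset.Ico 1 (n + 1)) := by
      funext ω
      rw [indexSum, Finset.sum_Ico_eq_sum_range]
      exact Finset.sum_congr rfl fun i _ => by rw [add_comm]
    have hv : Var[fun ω => ∑ j ∈ Finset.range n, X (j + 1) ω; P]
        = Var[indexSum X (Finset.range n); P] := by
      rw [e']
      exact (hs.identDistrib_indexSum (by omega)).variance_eq
    have hL : MemLp (fun ω => ∑ j ∈ Finset.range n, X (j + 1) ω) 2 P := by
      rw [e']
      exact memLp_indexSum hX _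
    rw [e, variance_fun_add (hX 0) hL, hv,
      covariance_fun_sum_right' (fun i _ => hX (i + 1)) (hX 0)]
    simp only [hu]
    ring
  have hsum' : ∀ n, Var[indexSum X (Finset.range n); P] = ∑ i ∈ Finset.range n, u i := by
    intro n
    induction n with
    | zero =>
      have : indexSum X (Finset.range 0) = fun _ => (0 : ℝ) := by
        funext ω; simp [indexSum]
      rw [this]
      exact variance_zero P
    | succ n ih => rw [hrec, ih, Finset.sum_range_succ]
  simp_rw [hsum', div_eq_inv_mul]
  exact tu.cesaro

lemma tendsto_natDiv_div (ℓ : ℕ) :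
    Tendsto (fun n : ℕ => ((n / ℓ : ℕ) : ℝ) / n) atTop (𝓝 ((ℓ : ℝ)⁻¹)) := by
  have h := (tendsto_nat_floor_mul_div_atTop (R := ℝ) (a := (ℓ : ℝ)⁻¹) (by positivity)).comp
    tendsto_natCast_atTop_atTop
  refine h.congr fun n => ?_
  rw [Function.comp_apply, ← div_eq_inv_mul, Nat.floor_div_eq_div]

/-- Newman's central limit theorem for stationary associated sequences. -/
theorem IsAssociated.tendstoInDistribution_of_stationary (h : IsAssociated P X)
    (hm : ∀ i, Measurable (X i)) (h0 : ∀ i, ∫ ω, X i ω ∂P = 0) (hs : IsStationarySeq P X)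
    (hX0 : MemLp (X 0) 2 P) (hsum : Summable (fun j : ℕ => cov[X 0, X (j + 1); P])) :
    TendstoInDistribution (fun (n : ℕ) ω => partialSum X n ω / √(n : ℝ)) atTop
      (id : ℝ → ℝ) (fun _ => P) (gaussianReal 0 (asymptoticVariance P X).toNNReal) := by
  have hX : ∀ i, MemLp (X i) 2 P := fun i => (hs.identDistrib i).memLp_iff.2 hX0
  have tvar := hs.tendsto_variance_div hX hsum
  set σ2 := asymptoticVariance P X with hσ2
  set V : ℕ → ℝ := fun n => Var[indexSum X (Finset.range n); P] with hV
  have hV0 : ∀ n, 0 ≤ V n := fun n => variance_nonneg _ _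
  -- As a limit of variances, `σ2` is non-negative, so `toNNReal` does not truncate it.
  have hσ : 0 ≤ σ2 := ge_of_tendsto' tvar fun n => div_nonneg (hV0 n) (Nat.cast_nonneg n)
  refine tendstoInDistribution_gaussianReal
    (fun n => (measurable_indexSum hm (Finset.range n)).div_const _) hσ fun t => ?_
  change Tendsto (fun n : ℕ => charFun (P.map (fun ω => partialSum X n ω / √(n : ℝ))) t) atTop _
  set G : ℝ → ℝ := fun v => Real.exp (-(t ^ 2 * v / 2)) with hG
  have hGc : Continuous G := by fun_prop
  set R : ℕ → ℕ → ℝ := fun ℓ n => ∫ ω, min ((t / √(n : ℝ) * indexSum X (Finset.range ℓ) ω) ^ 2)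
      (|t / √(n : ℝ) * indexSum X (Finset.range ℓ) ω| ^ 3) ∂P with hR
  have hR0 : ∀ ℓ n, 0 ≤ R ℓ n := fun ℓ n => integral_nonneg fun ω => by positivity
  -- The general bound for `n / ℓ` identically distributed blocks, plus the cost of replacing the
  -- Gaussian variance (n/ℓ) V_ℓ / n by `σ2`.
  set b : ℕ → ℕ → ℝ := fun ℓ n => |t| * √(V ℓ) / √(n : ℝ)
    + 2 * t ^ 2 * (V n / n - ((n / ℓ : ℕ) : ℝ) / n * V ℓ)
    + 3 * (n * R ℓ n) + t ^ 4 / 4 * V ℓ ^ 2 / n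
    + |G (((n / ℓ : ℕ) : ℝ) / n * V ℓ) - G σ2| with hb
  have hbound : ∀ ℓ n, 0 < ℓ → 0 < n →
      ‖charFun (P.map (fun ω => partialSum X n ω / √(n : ℝ))) t - (G σ2 : ℂ)‖ ≤ b ℓ n := by
    intro ℓ n hℓ hn
    have hn0 : (0 : ℝ) < n := Nat.cast_pos.2 hn
    have hn' : (0 : ℝ) < √(n : ℝ) := Real.sqrt_pos.2 hn0
    have hsq : √(n : ℝ) ^ 2 = n := Real.sq_sqrt hn0.le
    have hq : (t / √(n : ℝ)) ^ 4 = t ^ 4 / n ^ 2 := by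
      rw [div_pow, show (4 : ℕ) = 2 * 2 by rfl, pow_mul √(n : ℝ), hsq]
    have key := h.norm_charFun_sub_exp_le hm hX h0 ℓ (n / ℓ) (n % ℓ) (Nat.mod_lt n hℓ).le
      (t / √(n : ℝ))
    have hvar : ∀ j, Var[indexSum X (blockIndices ℓ j); P] = V ℓ :=
      fun j => (hs.identDistrib_block ℓ j).variance_eq
    have hmin : ∀ j, ∫ ω, min ((t / √(n : ℝ) * indexSum X (blockIndices ℓ j) ω) ^ 2)
        (|t / √(n : ℝ) * indexSum X (blockIndices ℓ j) ω| ^ 3) ∂P = R ℓ n := fun j =>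
      ((hs.identDistrib_block ℓ j).comp (u := fun x : ℝ => min ((t / √(n : ℝ) * x) ^ 2)
        (|t / √(n : ℝ) * x| ^ 3)) (by fun_prop)).integral_eq
    rw [mul_comm (n / ℓ) ℓ, Nat.div_add_mod] at key
    simp only [hvar, hmin, Finset.sum_const, Finset.card_range, nsmul_eq_mul] at key
    rw [charFun_map_div (Y := partialSum X n)
      (measurable_indexSum hm (Finset.range n)).aemeasurable]
    have hmn : ((n / ℓ : ℕ) : ℝ) ≤ n := Nat.cast_le.2 (Nat.div_le_self n ℓ)
    have e0 : (t / √(n : ℝ)) ^ 2 * (((n / ℓ : ℕ) : ℝ) * V ℓ) / 2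
        = t ^ 2 * (((n / ℓ : ℕ) : ℝ) / n * V ℓ) / 2 := by
      rw [div_pow, hsq]
      ring
    rw [e0] at key
    have e1 : |t / √(n : ℝ)| * √(V ℓ) = |t| * √(V ℓ) / √(n : ℝ) := by
      rw [abs_div, abs_of_pos hn']
      ring
    have e2 : 2 * (t / √(n : ℝ)) ^ 2 * (V n - ((n / ℓ : ℕ) : ℝ) * V ℓ)
        = 2 * t ^ 2 * (V n / n - ((n / ℓ : ℕ) : ℝ) / n * V ℓ) := by
      rw [div_pow, hsq]
      ring
    have e3 : 3 * (((n / ℓ : ℕ) : ℝ) * R ℓ n) ≤ 3 * (n * R ℓ n) := by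
      have := mul_le_mul_of_nonneg_right hmn (hR0 ℓ n)
      linarith
    have e4 : (t / √(n : ℝ)) ^ 4 / 4 * (((n / ℓ : ℕ) : ℝ) * V ℓ ^ 2)
        ≤ t ^ 4 / 4 * V ℓ ^ 2 / n := by
      rw [hq]
      have h1 : t ^ 4 / (n : ℝ) ^ 2 / 4 * (n * V ℓ ^ 2) = t ^ 4 / 4 * V ℓ ^ 2 / n := by
        field_simp
      rw [← h1]
      have h2 : 0 ≤ t ^ 4 / (n : ℝ) ^ 2 / 4 := by positivity
      exact mul_le_mul_of_nonneg_left (mul_le_mul_of_nonneg_right hmn (sq_nonneg _)) h2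
    have e5 := norm_sub_le_norm_sub_add_norm_sub (charFun (P.map (partialSum X n)) (t / √(n : ℝ)))
      ((G (((n / ℓ : ℕ) : ℝ) / n * V ℓ) : ℝ) : ℂ) ((G σ2 : ℝ) : ℂ)
    have e6 : ‖((G (((n / ℓ : ℕ) : ℝ) / n * V ℓ) : ℝ) : ℂ) - ((G σ2 : ℝ) : ℂ)‖
        = |G (((n / ℓ : ℕ) : ℝ) / n * V ℓ) - G σ2| := by
      rw [← Complex.ofReal_sub, Complex.norm_real, Real.norm_eq_abs]
    rw [e6] at e5
    refine e5.trans (add_le_add ?_ le_rfl)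
    exact key.trans (add_le_add (add_le_add (add_le_add e1.le e2.le) e3) e4)
  -- At fixed `ℓ`, the terms that survive as n → ∞ are the covariance defect between blocks and the
  -- error in the Gaussian variance. At `ℓ = 0` the claim holds by the conventions for division by
  -- zero.
  have tb : ∀ ℓ, Tendsto (b ℓ) atTop
      (𝓝 (2 * t ^ 2 * (σ2 - V ℓ / ℓ) + |G (V ℓ / ℓ) - G σ2|)) := by
    intro ℓ
    have tsq : Tendsto (fun n : ℕ => √(n : ℝ)) atTop atTop :=
      Real.tendsto_sqrt_atTop.comp tendsto_natCast_atTop_atTop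
    have tm : Tendsto (fun n : ℕ => ((n / ℓ : ℕ) : ℝ) / n * V ℓ) atTop (𝓝 (V ℓ / ℓ)) := by
      rw [div_eq_inv_mul]
      exact (tendsto_natDiv_div ℓ).mul_const _
    have t1 : Tendsto (fun n : ℕ => |t| * √(V ℓ) / √(n : ℝ)) atTop (𝓝 0) :=
      tendsto_const_nhds.div_atTop tsq
    have t2 := (tvar.sub tm).const_mul (2 * t ^ 2)
    have t3 := (tendsto_mul_integral_min_sq_cube (memLp_indexSum hX (Finset.range ℓ)) t).const_mul 3
    have t4 : Tendsto (fun n : ℕ => t ^ 4 / 4 * V ℓ ^ 2 / n) atTop (𝓝 0) :=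
      tendsto_const_nhds.div_atTop tendsto_natCast_atTop_atTop
    have t5 := (((hGc.tendsto _).comp tm).sub_const (G σ2)).abs
    have := (((t1.add t2).add t3).add t4).add t5
    rw [zero_add, mul_zero, add_zero, add_zero] at this
    exact this
  have tlim : Tendsto (fun ℓ : ℕ => 2 * t ^ 2 * (σ2 - V ℓ / ℓ) + |G (V ℓ / ℓ) - G σ2|) atTop
      (𝓝 0) := by
    have := ((tvar.const_sub σ2).const_mul (2 * t ^ 2)).add
      (((hGc.tendsto _).comp tvar).sub_const (G σ2)).abs
    simpa using this
  rw [tendsto_iff_norm_sub_tendsto_zero]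
  refine tendsto_order.2 ⟨fun a ha => Eventually.of_forall fun n => ha.trans_le (norm_nonneg _),
    fun ε hε => ?_⟩
  -- The order of limits matters: `ℓ` is chosen from `ε` alone, and only then does `n` grow.
  obtain ⟨ℓ, hℓ, hℓ0⟩ :=
    ((tlim.eventually (gt_mem_nhds hε)).and (eventually_gt_atTop 0)).exists
  filter_upwards [(tb ℓ).eventually (gt_mem_nhds hℓ), eventually_gt_atTop 0] with n hn hn0
  exact (hbound ℓ n hℓ0 hn0).trans_lt hn

end Stationary

end AssocCLT

theorem theorem1 {Ω : Type*} [MeasurableSpace Ω] (P : Measure Ω) [IsProbabilityMeasure P]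
    (X : ℕ → Ω → ℝ) (hmeas : ∀ i, Measurable (X i))
    (hint : ∀ i, Integrable (X i) P) (hmean : ∀ i, ∫ ω, X i ω ∂P = 0)
    (hassoc : AssocCLT.IsAssociated P X) :
    (AssocCLT.IsStationarySeq P X → MemLp (X 0) 2 P →
      Summable (fun j : ℕ => cov[X 0, X (j + 1); P]) →
      TendstoInDistribution (fun (n : ℕ) ω => AssocCLT.partialSum X n ω / √(n : ℝ)) atTop
        (id : ℝ → ℝ) (fun _ => P)
        (gaussianReal 0 (AssocCLT.asymptoticVariance P X).toNNReal)) ∧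
    (∀ (ℓ m r : ℕ → ℕ) (δ : ℝ), 0 < δ → AssocCLT.CondL ℓ m r → AssocCLT.CondH0 P X ℓ →
      AssocCLT.CondHa P X ℓ m → AssocCLT.CondHb P X ℓ m → AssocCLT.CondHc P X ℓ m δ →
      TendstoInDistribution (fun (n : ℕ) ω => AssocCLT.partialSum X n ω / AssocCLT.sd P X n) atTop
        (id : ℝ → ℝ) (fun _ => P) (gaussianReal 0 1)) := by
  refine ⟨fun hs hX0 hsum => hassoc.tendstoInDistribution_of_stationary hmeas hmean hs hX0 hsum,
    fun ℓ m r δ hδ hL _ ha hb hc =>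
      hassoc.tendstoInDistribution_of_lyapounov hmeas hmean hδ hL ha hb hc⟩
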